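/- Let $E$ be an elliptic curve over $\mathbb{Q}$ defined by a Weierstrass equation $y^2+a_1xy+a_3y=x^3+a_2x^2+a_4x+a_6$ with integer coefficients, and let $P\in E(\mathbb{Q})$, $P\neq O$, be a torsion point. For $n\ge 0$ with $nP\neq O$ write $x(nP)=A_n/B_n^2$ with $A_n,B_n$ coprime integers and $B_n>0$; if $nP=O$ put $B_n=0$. Let $\psi_n$ be the $n$-th division polynomial of $E$ and define $$\beta_n=\beta_n(E,P)=\operatorname{sign}\bigl(\psi_n(x(P),y(P))\bigr)\cdot\frac{B_n}{B_1},\qquad n\geq 0 .$$ For a prime $p$ let $E_0(\mathbb{Q}_p)$ be the group of points of $E(\mathbb{Q}_p)$ whose reduction modulo $p$ (with respect to the given equation) is nonsingular, let $r(p,P)$ be the order of $P$ in $E(\mathbb{Q}_p)/E_0(\mathbb{Q}_p)$, and let $M(P)=\operatorname{lcm}_p r(p,P)$. If $M(P)=1$, then for all integers $m\geq n\geq r\geq 0$, $$\beta_{m+n}\,\beta_{m-n}\,\beta_r^2=\beta_{m+r}\,\beta_{m-r}\,\beta_n^2-\beta_{n+r}\,\beta_{n-r}\,\beta_m^2 .$$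 -/

import Mathlib

noncomputable section

namespace EDS

open WeierstrassCurve

/-- The group `E(K)` of `K`-rational points of the curve defined by the Weierstrass equation `E`
with integer coefficients. -/
abbrev Pt (E : WeierstrassCurve ℤ) (K : Type) [Field K] : Type :=
  (E.baseChange K).toAffine.Point

/-- The subset `E₀(ℚ_p) ⊆ E(ℚ_p)` of points whose reduction modulo `p` is a nonsingular point of the
reduced curve. A point `(x, y)` with `x` or `y` not in `ℤ_p`, like `O` itself, reduces to the point
at infinity, which is always nonsingular; a point `(x, y)` with `x, y ∈ ℤ_p` reduces to
`(x mod p, y mod p)`. -/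
def nonsingularReduction (E : WeierstrassCurve ℤ) (p : ℕ) [Fact p.Prime] : Set (Pt E ℚ_[p]) :=
  {Q | match Q with
    | .zero => True
    | .some x y _ => ∀ x' y' : ℤ_[p], (x' : ℚ_[p]) = x → (y' : ℚ_[p]) = y →
        (E.map (Int.castRingHom (ZMod p))).toAffine.Nonsingular
          (PadicInt.toZMod x') (PadicInt.toZMod y')}

open Classical in
/-- `r(p, P)`: the order of `P` in `E(ℚ_p)/E₀(ℚ_p)`, that is, the least `n ≥ 1` such that
`nP ∈ E₀(ℚ_p)`. -/
def localOrder (E : WeierstrassCurve ℤ) (p : ℕ) [Fact p.Prime] (P : Pt E ℚ) : ℕ :=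
  sInf {n : ℕ | 0 < n ∧
    n • (Affine.Point.map (W' := E.toAffine) (Algebra.ofId ℚ ℚ_[p]) P : Pt E ℚ_[p]) ∈
      nonsingularReduction E p}

/-- `M(P)`: the least common multiple of `r(p, P)` over all primes `p`, that is, the least positive
integer divisible by all of them. -/
def M (E : WeierstrassCurve ℤ) (P : Pt E ℚ) : ℕ :=
  sInf {N : ℕ | 0 < N ∧ ∀ (p : ℕ) [Fact p.Prime], localOrder E p P ∣ N}

/-- The nonnegative square root of the denominator of `x(Q)` (in lowest terms), and `0` if `Q = O`.
For `Q ∈ E(ℚ)` the denominator is a perfect square, as `E` has integer coefficients, so that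
`Nat.sqrt` is its exact square root. -/
def denomRoot (E : WeierstrassCurve ℤ) : Pt E ℚ → ℕ
  | .zero => 0
  | .some x _ _ => Nat.sqrt x.den

/-- `B_n(E, P)`, where `x(nP) = A_n / B_n²` in lowest terms, and `B_n = 0` if `nP = O`. -/
def B (E : WeierstrassCurve ℤ) (P : Pt E ℚ) (n : ℕ) : ℕ :=
  denomRoot E (n • P)

/-- The value `ψ_n(x(P), y(P))` of the `n`-th division polynomial of `E` at an affine point `P`
(with the junk value `0` at `O`). -/
def psiAt (E : WeierstrassCurve ℤ) : Pt E ℚ → ℕ → ℚ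
  | .zero, _ => 0
  | .some x y _, n => ((E.baseChange ℚ).ψ n).evalEval x y

/-- `β_n(E, P) = sign(ψ_n(x(P), y(P))) · B_n(E, P) / B_1(E, P)`, for a point `P ≠ O`. -/
def beta (E : WeierstrassCurve ℤ) (P : Pt E ℚ) (n : ℕ) : ℚ :=
  (SignType.sign (psiAt E P n) : ℚ) * ((B E P n : ℚ) / (B E P 1 : ℚ))

end EDS

end

/-! Write x(P) = A/b² in lowest terms. The core is the formula β_n = b^(n²-1) ψ_n(P) (`beta_eq`).
The values ψ_n(P) form a normalised elliptic divisibility sequence, so they satisfy the relation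
(`elliptic_relation`). The factor b^(n²-1) preserves it, since (m+n)² + (m-n)² + 2r² is symmetric in
m, n, r.

For the formula, x(nP) = φ_n/ψ_n² (`repX_nsmul`), and scaling both by b^(2n²) gives integers. They
are coprime (`isCoprime_homEval`). At a prime dividing b this holds because Φ_n is monic of degree
n². At any other prime, M(P) = 1 makes the reduction of P nonsingular, and over any field φ_n and
ψ_n² have no common zero at a nonsingular point, again by `repX_nsmul`. Hence B_n = b^(n²) |ψ_n(P)|,
and the sign in β_n removes the absolute value. -/

namespace NormEDS

/-! ### The elliptic relation from the duplication recurrences -/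

variable {R : Type*} [CommRing R]

/-- The elliptic relation with `r = 1`. -/
def EvenRel (W : ℤ → R) (p q : ℤ) : Prop :=
  W (p + q) * W (p - q) = W (p + 1) * W (p - 1) * W q ^ 2 - W (q + 1) * W (q - 1) * W p ^ 2

/-- The half-integral analogue of `EvenRel`. -/
def OddRel (W : ℤ → R) (p q : ℤ) : Prop :=
  W (p + q + 1) * W (p - q) * W 2 =
    W (p + 2) * W (p - 1) * (W (q + 1) * W q) - W (p + 1) * W p * (W (q + 2) * W (q - 1))

/-- The Plücker relation among the even atoms. -/
theorem EvenRel.plucker {W : ℤ → R} {a b c d : ℤ} (hab : EvenRel W a b) (hcd : EvenRel W c d)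
    (hac : EvenRel W a c) (hbd : EvenRel W b d) (had : EvenRel W a d) (hbc : EvenRel W b c) :
    W (a + b) * W (a - b) * (W (c + d) * W (c - d)) -
      W (a + c) * W (a - c) * (W (b + d) * W (b - d)) +
      W (a + d) * W (a - d) * (W (b + c) * W (b - c)) = 0 := by
  unfold EvenRel at *
  rw [hab, hcd, hac, hbd, had, hbc]
  ring

/-- The Plücker relation among the odd atoms. -/
theorem OddRel.plucker {W : ℤ → R} {a b c d : ℤ} (hab : OddRel W a b) (hcd : OddRel W c d)
    (hac : OddRel W a c) (hbd : OddRel W b d) (had : OddRel W a d) (hbc : OddRel W b c) :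
    W 2 ^ 2 * (W (a + b + 1) * W (a - b) * (W (c + d + 1) * W (c - d)) -
      W (a + c + 1) * W (a - c) * (W (b + d + 1) * W (b - d)) +
      W (a + d + 1) * W (a - d) * (W (b + c + 1) * W (b - c))) = 0 := by
  unfold OddRel at *
  have : ∀ x y z t u v : R, W 2 ^ 2 * (x * y - z * t + u * v) =
    (x * W 2) * (y * W 2) - (z * W 2) * (t * W 2) + (u * W 2) * (v * W 2) := by intros; ring
  rw [this, hab, hcd, hac, hbd, had, hbc]
  ring

/-- Both relations equate a product with a 2 × 2 minor, and minors satisfy a Plücker relation. Since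
`OddRel` at (p, q) is the relation at (p + 1/2, q + 1/2), the induction runs on twice the larger
index. The recurrences are the cases q = p - 1. -/
theorem evenRel_and_oddRel_of_le [IsDomain R] {W : ℤ → R} (odd : ∀ n, W (-n) = -W n)
    (zero : W 0 = 0) (one : W 1 = 1) (two : W 2 ≠ 0)
    (even_rec : ∀ m, W (2 * m) * W 2 =
      W (m - 1) ^ 2 * W m * W (m + 2) - W (m - 2) * W m * W (m + 1) ^ 2)
    (odd_rec : ∀ m, W (2 * m + 1) = W (m + 2) * W m ^ 3 - W (m - 1) * W (m + 1) ^ 3) (N : ℕ) :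
    ∀ p q : ℤ, 0 ≤ q → q ≤ p →
      (2 * p ≤ N → EvenRel W p q) ∧ (2 * p + 1 ≤ N → OddRel W p q) := by
  induction N using Nat.strong_induction_on with
  | _ N ih =>
  have ihe : ∀ p q : ℤ, 0 ≤ q → q ≤ p → 2 * p < N → EvenRel W p q := fun p q h0 h1 h2 ↦
    (ih (2 * p).toNat (by omega) p q h0 h1).1 (by omega)
  have iho : ∀ p q : ℤ, 0 ≤ q → q ≤ p → 2 * p + 1 < N → OddRel W p q := fun p q h0 h1 h2 ↦
    (ih (2 * p + 1).toNat (by omega) p q h0 h1).2 (by omega)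
  have neg_one : W (-1) = -1 := by rw [odd, one]
  intro p q hq hqp
  constructor
  · intro hp
    unfold EvenRel
    obtain rfl | rfl | rfl | ⟨hq0, hqp⟩ :
        p = q ∨ q = p - 1 ∨ q = 0 ∨ 1 ≤ q ∧ q ≤ p - 2 := by omega
    · rw [sub_self, zero]; ring
    · have h := odd_rec (p - 1)
      rw [show 2 * (p - 1) + 1 = p + (p - 1) by ring, show p - 1 + 2 = p + 1 by ring] at h
      rw [h, sub_sub_cancel, one, sub_add_cancel]
      ring
    · simp [zero, one, neg_one, sq]
    -- Plücker at (p+q±1)/2 and (p-q±1)/2: both pairs have difference 1, so the first product is the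
    -- left side sought. These numbers are half-integers when p + q is even and integers when it is
    -- odd.
    rcases Int.even_or_odd (p + q) with ⟨i, hi⟩ | ⟨i, hi⟩
    · obtain ⟨j, hj⟩ : ∃ j, p - q = j + j := ⟨i - q, by omega⟩
      have h := OddRel.plucker
        (iho i (i - 1) (by omega) (by omega) (by omega))
        (iho j (j - 1) (by omega) (by omega) (by omega))
        (iho i j (by omega) (by omega) (by omega))
        (iho (i - 1) (j - 1) (by omega) (by omega) (by omega))
        (iho i (j - 1) (by omega) (by omega) (by omega))
        (iho (i - 1) j (by omega) (by omega) (by omega))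
      rw [show i + (i - 1) + 1 = p + q by omega, show i - (i - 1) = 1 by omega,
        show j + (j - 1) + 1 = p - q by omega, show j - (j - 1) = 1 by omega,
        show i + j + 1 = p + 1 by omega, show i - j = q by omega,
        show i - 1 + (j - 1) + 1 = p - 1 by omega, show i - 1 - (j - 1) = q by omega,
        show i + (j - 1) + 1 = p by omega, show i - (j - 1) = q + 1 by omega,
        show i - 1 + j + 1 = p by omega, show i - 1 - j = q - 1 by omega, one] at h
      linear_combination (mul_eq_zero.mp h).resolve_left (pow_ne_zero _ two)
    · obtain ⟨j, hj⟩ : ∃ j, p - q + 1 = 2 * j := ⟨i + 1 - q, by omega⟩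
      have h := EvenRel.plucker
        (ihe (i + 1) i (by omega) (by omega) (by omega))
        (ihe j (j - 1) (by omega) (by omega) (by omega))
        (ihe (i + 1) j (by omega) (by omega) (by omega))
        (ihe i (j - 1) (by omega) (by omega) (by omega))
        (ihe (i + 1) (j - 1) (by omega) (by omega) (by omega))
        (ihe i j (by omega) (by omega) (by omega))
      rw [show i + 1 + i = p + q by omega, show i + 1 - i = 1 by omega,
        show j + (j - 1) = p - q by omega, show j - (j - 1) = 1 by omega,
        show i + 1 + j = p + 1 by omega, show i + 1 - j = q by omega,
        show i + (j - 1) = p - 1 by omega, show i - (j - 1) = q by omega,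
        show i + 1 + (j - 1) = p by omega, show i + 1 - (j - 1) = q + 1 by omega,
        show i + j = p by omega, show i - j = q - 1 by omega, one] at h
      linear_combination h
  · intro hp
    unfold OddRel
    obtain rfl | rfl | rfl | ⟨hq0, hqp⟩ :
        p = q ∨ q = p - 1 ∨ q = 0 ∨ 1 ≤ q ∧ q ≤ p - 2 := by omega
    · rw [sub_self, zero]; ring
    · rw [show p + (p - 1) + 1 = 2 * p by ring, sub_sub_cancel, one, mul_one, even_rec,
        sub_add_cancel, show p - 1 + 2 = p + 1 by ring, show p - 1 - 1 = p - 2 by ring]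
      ring
    · simp [zero, one, neg_one]
    -- Now the second pair has difference 2, which produces the factor `W 2`.
    rcases Int.even_or_odd (p + q) with ⟨i, hi⟩ | ⟨i, hi⟩
    · obtain ⟨j, hj⟩ : ∃ j, p - q + 2 = 2 * j := ⟨i - q + 1, by omega⟩
      have h := EvenRel.plucker
        (ihe (i + 1) i (by omega) (by omega) (by omega))
        (ihe j (j - 2) (by omega) (by omega) (by omega))
        (ihe (i + 1) j (by omega) (by omega) (by omega))
        (ihe i (j - 2) (by omega) (by omega) (by omega))
        (ihe (i + 1) (j - 2) (by omega) (by omega) (by omega))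
        (ihe i j (by omega) (by omega) (by omega))
      rw [show i + 1 + i = p + q + 1 by omega, show i + 1 - i = 1 by omega,
        show j + (j - 2) = p - q by omega, show j - (j - 2) = 2 by omega,
        show i + 1 + j = p + 2 by omega, show i + 1 - j = q by omega,
        show i + (j - 2) = p - 1 by omega, show i - (j - 2) = q + 1 by omega,
        show i + 1 + (j - 2) = p by omega, show i + 1 - (j - 2) = q + 2 by omega,
        show i + j = p + 1 by omega, show i - j = q - 1 by omega, one] at h
      linear_combination h
    · obtain ⟨j, hj⟩ : ∃ j, p - q + 1 = 2 * j := ⟨i - q + 1, by omega⟩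
      have h := OddRel.plucker
        (iho (i + 1) i (by omega) (by omega) (by omega))
        (iho j (j - 2) (by omega) (by omega) (by omega))
        (iho (i + 1) j (by omega) (by omega) (by omega))
        (iho i (j - 2) (by omega) (by omega) (by omega))
        (iho (i + 1) (j - 2) (by omega) (by omega) (by omega))
        (iho i j (by omega) (by omega) (by omega))
      rw [show i + 1 + i + 1 = p + q + 1 by omega, show i + 1 - i = 1 by omega,
        show j + (j - 2) + 1 = p - q by omega, show j - (j - 2) = 2 by omega,
        show i + 1 + j + 1 = p + 2 by omega, show i + 1 - j = q by omega,
        show i + (j - 2) + 1 = p - 1 by omega, show i - (j - 2) = q + 1 by omega,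
        show i + 1 + (j - 2) + 1 = p by omega, show i + 1 - (j - 2) = q + 2 by omega,
        show i + j + 1 = p + 1 by omega, show i - j = q - 1 by omega, one] at h
      linear_combination (mul_eq_zero.mp h).resolve_left (pow_ne_zero _ two)

/-! ### Specialisation from ℤ[b, c, d], and Ward's invariant -/

section Universal

open MvPolynomial

theorem eq_map_universal (b c d : R) (n : ℤ) : normEDS b c d n =
    aeval ![b, c, d] (normEDS (X 0) (X 1) (X 2) n : MvPolynomial (Fin 3) ℤ) := by
  simp

/-- The sequence with parameters `2, 3, 2` is the identity. -/
theorem normEDS_two_three_two (n : ℕ) : normEDS (2 : ℤ) 3 2 n = n := by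
  induction n using normEDSRec with
  | zero => simp
  | one => simp
  | two => simp
  | three => simp
  | four => simp
  | even m h1 h2 h3 h4 h5 =>
    have h := normEDS_even (2 : ℤ) 3 2 (m + 3 : ℕ)
    push_cast at *
    rw [show (m + 3 - 1 : ℤ) = m + 2 by ring, show (m + 3 + 2 : ℤ) = m + 5 by ring,
      show (m + 3 - 2 : ℤ) = m + 1 by ring, show (m + 3 + 1 : ℤ) = m + 4 by ring,
      h1, h2, h3, h4, h5] at h
    exact mul_right_cancel₀ two_ne_zero (h.trans (by ring))
  | odd m h1 h2 h3 h4 =>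
    have h := normEDS_odd (2 : ℤ) 3 2 (m + 2 : ℕ)
    push_cast at *
    rw [show (m + 2 - 1 : ℤ) = m + 1 by ring, show (m + 2 + 2 : ℤ) = m + 4 by ring,
      show (m + 2 + 1 : ℤ) = m + 3 by ring, h1, h2, h3, h4] at h
    rw [h]
    ring

theorem universal_ne_zero {n : ℕ} (hn : n ≠ 0) :
    (normEDS (X 0) (X 1) (X 2) n : MvPolynomial (Fin 3) ℤ) ≠ 0 := fun h ↦ by
  have := eq_map_universal (2 : ℤ) 3 2 n
  rw [h, normEDS_two_three_two, map_zero] at this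
  exact hn (by exact_mod_cast this)

/-- Over ℤ[b, c, d] the second term is a nonzero variable in a domain; specialising then covers
every ring. -/
theorem evenRel (b c d : R) {p q : ℤ} (hq : 0 ≤ q) (hqp : q ≤ p) :
    EvenRel (normEDS b c d) p q := by
  have h := (evenRel_and_oddRel_of_le (W := normEDS (X 0) (X 1) (X 2 : MvPolynomial (Fin 3) ℤ))
    (normEDS_neg _ _ _) (normEDS_zero ..) (normEDS_one ..)
    (by rw [normEDS_two]; exact X_ne_zero _)
    (fun m ↦ by rw [normEDS_two, normEDS_even]) (normEDS_odd _ _ _) (2 * p).toNat p q hq hqp).1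
    (by omega)
  simpa [EvenRel] using congr_arg (aeval ![b, c, d]) h

theorem somos_four (b c d : R) {n : ℤ} (hn : 2 ≤ n) :
    normEDS b c d (n + 2) * normEDS b c d (n - 2) =
      normEDS b c d (n + 1) * normEDS b c d (n - 1) * b ^ 2 - c * normEDS b c d n ^ 2 := by
  simpa [EvenRel] using evenRel b c d (by omega : (0 : ℤ) ≤ 2) hn

/-- The elliptic relation for `m ≥ n ≥ r ≥ 0`. -/
theorem elliptic_relation (b c d : R) {m n r : ℤ} (hr : 0 ≤ r) (hrn : r ≤ n) (hnm : n ≤ m) :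
    normEDS b c d (m + n) * normEDS b c d (m - n) * normEDS b c d r ^ 2 =
      normEDS b c d (m + r) * normEDS b c d (m - r) * normEDS b c d n ^ 2 -
        normEDS b c d (n + r) * normEDS b c d (n - r) * normEDS b c d m ^ 2 := by
  have h1 := evenRel b c d (hr.trans hrn) hnm
  have h2 := evenRel b c d hr (hrn.trans hnm)
  have h3 := evenRel b c d hr hrn
  unfold EvenRel at h1 h2 h3
  rw [h1, h2, h3]
  ring

/-- The numerator of Ward's invariant: `invarNum / invarDenom` does not depend on the index. -/
def invarNum (b c d : R) (n : ℤ) : R :=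
  normEDS b c d (n + 2) * normEDS b c d (n - 1) ^ 2 +
    normEDS b c d (n - 2) * normEDS b c d (n + 1) ^ 2 + b ^ 2 * normEDS b c d n ^ 3

/-- The denominator of Ward's invariant. -/
def invarDenom (b c d : R) (n : ℤ) : R :=
  normEDS b c d (n - 1) * normEDS b c d n * normEDS b c d (n + 1)

/-- Consecutive values of the ratio differ by a combination of two Somos-4 relations. The universal
ring is used because the comparison cancels a denominator. -/
theorem invar_universal (n : ℕ) :
    let b : MvPolynomial (Fin 3) ℤ := X 0
    let c : MvPolynomial (Fin 3) ℤ := X 1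
    let d : MvPolynomial (Fin 3) ℤ := X 2
    invarNum b c d (n + 1) * c = (d + b ^ 4) * invarDenom b c d (n + 1) := by
  intro b c d
  induction n with
  | zero => simp [invarNum, invarDenom]
  | succ n ih =>
    -- At index 1 the identity is 0 = 0 and its denominator contains W 0, so index 2 is checked
    -- directly and gives the constant (d + b⁴)/c.
    obtain rfl | hn := Nat.eq_zero_or_pos n
    · simp [invarNum, invarDenom]
      ring
    have hs := somos_four b c d (n := n + 2) (by omega)
    have hs' := somos_four b c d (n := n + 1) (by omega)
    have hne : invarDenom b c d (n + 1) ≠ 0 := by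
      have h1 := universal_ne_zero (n := n) (by omega)
      have h2 := universal_ne_zero (n := n + 1) (by omega)
      have h3 := universal_ne_zero (n := n + 2) (by omega)
      unfold invarDenom
      push_cast at h2 h3
      rw [add_sub_cancel_right, show (n + 1 + 1 : ℤ) = n + 2 by ring]
      exact mul_ne_zero (mul_ne_zero h1 h2) h3
    apply mul_left_cancel₀ hne
    push_cast
    unfold invarNum invarDenom at *
    rw [show (n + 1 + 2 : ℤ) = n + 3 by ring, show (n + 1 - 1 : ℤ) = n by ring,
      show (n + 1 - 2 : ℤ) = n - 1 by ring, show (n + 1 + 1 : ℤ) = n + 2 by ring] at *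
    rw [show (n + 2 + 2 : ℤ) = n + 4 by ring, show (n + 2 - 1 : ℤ) = n + 1 by ring,
      show (n + 2 - 2 : ℤ) = n by ring, show (n + 2 + 1 : ℤ) = n + 3 by ring] at *
    generalize normEDS b c d (n + 3) = w3 at *
    generalize normEDS b c d (n + 4) = w4 at *
    generalize normEDS b c d (n + 2) = w2 at *
    generalize normEDS b c d (n + 1) = w1 at *
    generalize normEDS b c d n = w0 at *
    generalize normEDS b c d (n - 1) = w at *
    linear_combination c * w1 ^ 3 * w2 * hs - c * w1 * w2 ^ 3 * hs' + w1 * w2 * w3 * ih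

theorem invar (b c d : R) (n : ℕ) :
    invarNum b c d (n + 1) * c = (d + b ^ 4) * invarDenom b c d (n + 1) := by
  simpa only [invarNum, invarDenom, map_mul, map_add, map_pow, map_normEDS, aeval_X,
    Matrix.cons_val] using congr_arg (aeval ![b, c, d]) (invar_universal n)

end Universal

end NormEDS
-- Values of division polynomials at a point
namespace WeierstrassCurve

open NormEDS Polynomial

section DivisionValue

variable {R : Type*} [CommRing R] (W : WeierstrassCurve R) (x y : R)

/-- The value of the `n`-th division polynomial at `(x, y)`, as a term of a normalised EDS. -/
noncomputable def divVal (n : ℤ) : R :=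
  normEDS (2 * y + W.a₁ * x + W.a₃) (W.Ψ₃.eval x) (W.preΨ₄.eval x) n

/-- The value of `φ_n` at `(x, y)`. -/
noncomputable def phiVal (n : ℤ) : R :=
  x * divVal W x y n ^ 2 - divVal W x y (n + 1) * divVal W x y (n - 1)

theorem evalEval_ψ₂ : W.ψ₂.evalEval x y = 2 * y + W.a₁ * x + W.a₃ := by
  rw [ψ₂, Affine.evalEval_polynomialY]

theorem evalEval_ψ (n : ℤ) : (W.ψ n).evalEval x y = divVal W x y n := by
  rw [divVal, ← evalEval_ψ₂, WeierstrassCurve.ψ]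
  have := map_normEDS (evalEvalRingHom x y) W.ψ₂ (C W.Ψ₃) (C W.preΨ₄) n
  simpa only [coe_evalEvalRingHom, evalEval_C] using this

theorem evalEval_φ (n : ℤ) : (W.φ n).evalEval x y = phiVal W x y n := by
  simp [WeierstrassCurve.φ, phiVal, evalEval_ψ, evalEval_sub, evalEval_mul, evalEval_pow, evalEval_C]

variable {W x y}

theorem evalEval_eq_of_mk_eq (h : W.toAffine.Equation x y) {f g : R[X][X]}
    (hfg : Affine.CoordinateRing.mk W f = Affine.CoordinateRing.mk W g) :
    f.evalEval x y = g.evalEval x y := by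
  obtain ⟨k, hk⟩ := AdjoinRoot.mk_eq_mk.mp hfg
  have := congr_arg (evalEval x y) hk
  rw [evalEval_sub, evalEval_mul, h, zero_mul] at this
  exact sub_eq_zero.mp this

theorem eval_ΨSq (h : W.toAffine.Equation x y) (n : ℤ) :
    (W.ΨSq n).eval x = divVal W x y n ^ 2 := by
  have := evalEval_eq_of_mk_eq h
    ((map_pow _ _ 2).trans ((congr_arg (· ^ 2) (Affine.CoordinateRing.mk_ψ W n)).trans
      (Affine.CoordinateRing.mk_Ψ_sq W n)))
  rwa [evalEval_pow, evalEval_ψ, evalEval_C, eq_comm] at this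

theorem eval_Φ (h : W.toAffine.Equation x y) (n : ℤ) :
    (W.Φ n).eval x = phiVal W x y n := by
  have := evalEval_eq_of_mk_eq h (Affine.CoordinateRing.mk_φ W n)
  rwa [evalEval_φ, evalEval_C, eq_comm] at this

theorem ψ₂_sq_eq (h : W.toAffine.Equation x y) : (2 * y + W.a₁ * x + W.a₃) ^ 2 =
    4 * x ^ 3 + W.b₂ * x ^ 2 + 2 * W.b₄ * x + W.b₆ := by
  rw [Affine.equation_iff] at h
  simp only [b₂, b₄, b₆]
  linear_combination 4 * h

/-- Evaluates Ward's invariant (d + b⁴)/c for division polynomials. -/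
theorem Ψ₃_mul_eq (h : W.toAffine.Equation x y) :
    W.Ψ₃.eval x * (6 * x ^ 2 + W.b₂ * x + W.b₄) =
      W.preΨ₄.eval x + (2 * y + W.a₁ * x + W.a₃) ^ 4 := by
  have h2 : (2 * y + W.a₁ * x + W.a₃) ^ 4 = _ := (pow_mul _ 2 2).trans
    (congr_arg (· ^ 2) (ψ₂_sq_eq h))
  rw [h2]
  simp only [Ψ₃, preΨ₄, eval_add, eval_mul, eval_pow, eval_X, eval_C, eval_ofNat]
  linear_combination -x ^ 2 * W.b_relation

end DivisionValue

section Universal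

open MvPolynomial

/-- The Weierstrass curve over `ℤ[a₁, a₂, a₃, a₄, x, y]` through the point `(x, y)`. -/
noncomputable def pointed : WeierstrassCurve (MvPolynomial (Fin 6) ℤ) where
  a₁ := X 0
  a₂ := X 1
  a₃ := X 2
  a₄ := X 3
  a₆ := X 5 ^ 2 + X 0 * X 4 * X 5 + X 2 * X 5 - (X 4 ^ 3 + X 1 * X 4 ^ 2 + X 3 * X 4)

theorem pointed_equation : pointed.toAffine.Equation (X 4) (X 5) := by
  rw [Affine.equation_iff]
  simp only [pointed]
  ring

variable {R : Type*} [CommRing R] {W : WeierstrassCurve R} {x y : R}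

/-- The equation determines a₆ from the other data, so pointed curves are parametrised by a
polynomial ring, which is a domain. -/
theorem exists_pointed_map (h : W.toAffine.Equation x y) :
    ∃ f : MvPolynomial (Fin 6) ℤ →+* R, pointed.map f = W ∧ f (X 4) = x ∧ f (X 5) = y := by
  rw [Affine.equation_iff] at h
  refine ⟨(MvPolynomial.aeval ![W.a₁, W.a₂, W.a₃, W.a₄, x, y]).toRingHom, ?_, ?_, ?_⟩
  · ext <;> simp [pointed]
    linear_combination h
  all_goals simp

theorem map_divVal {S : Type*} [CommRing S] (f : R →+* S) (n : ℤ) :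
    f (divVal W x y n) = divVal (W.map f) (f x) (f y) n := by
  simp only [divVal, map_normEDS, map_add, map_mul, map_ofNat, map_a₁, map_a₃, map_Ψ₃,
    map_preΨ₄, Polynomial.eval_map_apply]

theorem pointed_Ψ₃_ne_zero : pointed.Ψ₃.eval (X 4) ≠ 0 := fun h ↦ by
  -- The point (1, 1) on y² = x³, where Ψ₃ takes the value 3.
  have := congr_arg (MvPolynomial.aeval ![0, 0, 0, 0, (1 : ℤ), 1]) h
  simp [Ψ₃, pointed, b₂, b₄, b₆, b₈] at this

/-- Ψ₃ is cancelled over the universal pointed curve, so the identity survives at points where Ψ₃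
vanishes. -/
theorem invar_divVal (h : W.toAffine.Equation x y) (n : ℕ) :
    divVal W x y (n + 3) * divVal W x y n ^ 2 + divVal W x y (n - 1) * divVal W x y (n + 2) ^ 2 +
      (2 * y + W.a₁ * x + W.a₃) ^ 2 * divVal W x y (n + 1) ^ 3 = (6 * x ^ 2 + W.b₂ * x + W.b₄) *
        (divVal W x y n * divVal W x y (n + 1) * divVal W x y (n + 2)) := by
  obtain ⟨f, rfl, rfl, rfl⟩ := exists_pointed_map h
  have key := invar (2 * X 5 + pointed.a₁ * X 4 + pointed.a₃) (pointed.Ψ₃.eval (X 4))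
    (pointed.preΨ₄.eval (X 4)) n
  rw [← Ψ₃_mul_eq pointed_equation, mul_comm, mul_assoc] at key
  replace key := congr_arg f (mul_left_cancel₀ pointed_Ψ₃_ne_zero key)
  simp only [invarNum, invarDenom, ← divVal.eq_def] at key
  rw [show (n + 1 + 2 : ℤ) = n + 3 by ring, show (n + 1 - 1 : ℤ) = n by ring,
    show (n + 1 - 2 : ℤ) = n - 1 by ring, show (n + 1 + 1 : ℤ) = n + 2 by ring] at key
  simpa only [map_add, map_mul, map_pow, map_divVal, map_ofNat, map_a₁, map_a₃, map_b₂,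
    map_b₄] using key

theorem somos_four_divVal (n : ℕ) : divVal W x y (n + 3) * divVal W x y (n - 1) =
    divVal W x y (n + 2) * divVal W x y n * (2 * y + W.a₁ * x + W.a₃) ^ 2 -
      W.Ψ₃.eval x * divVal W x y (n + 1) ^ 2 := by
  obtain rfl | hn := Nat.eq_zero_or_pos n
  · simp [divVal]
  have := somos_four (2 * y + W.a₁ * x + W.a₃) (W.Ψ₃.eval x) (W.preΨ₄.eval x) (n := n + 1)
    (by omega)
  rwa [show (n + 1 + 2 : ℤ) = n + 3 by ring, show (n + 1 - 1 : ℤ) = n by ring,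
    show (n + 1 - 2 : ℤ) = n - 1 by ring, show (n + 1 + 1 : ℤ) = n + 2 by ring] at this

end Universal

/-! ### Homogeneous addition formulas for x(Q + P) and x(Q - P), with Q = (n+1)P -/

section AddSub

variable {R : Type*} [CommRing R] {W : WeierstrassCurve R} {x y : R}

theorem divVal_sq_mul_divVal_sq (n : ℕ) :
    divVal W x y (n + 2) ^ 2 * divVal W x y n ^ 2 =
      (phiVal W x y (n + 1) - x * divVal W x y (n + 1) ^ 2) ^ 2 := by
  rw [phiVal, show (n + 1 - 1 : ℤ) = n by ring, show (n + 1 + 1 : ℤ) = n + 2 by ring]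
  ring

/-- The homogeneous form of the formula for x(Q + P) + x(Q - P), with x(Q) = X/Z; it follows from
Ward's invariant. -/
theorem phiVal_mul_add (h : W.toAffine.Equation x y) (n : ℕ) :
    let X := phiVal W x y (n + 1)
    let Z := divVal W x y (n + 1) ^ 2
    phiVal W x y (n + 2) * divVal W x y n ^ 2 + phiVal W x y n * divVal W x y (n + 2) ^ 2 =
      2 * x * X * (X + x * Z) + W.b₂ * x * X * Z + W.b₄ * Z * (X + x * Z) + W.b₆ * Z ^ 2 := by
  have h1 := invar_divVal h n
  have h2 := ψ₂_sq_eq h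
  simp only [phiVal]
  rw [h2] at h1
  rw [show (n + 1 - 1 : ℤ) = n by ring, show (n + 1 + 1 : ℤ) = n + 2 by ring,
    show (n + 2 - 1 : ℤ) = n + 1 by ring, show (n + 2 + 1 : ℤ) = n + 3 by ring]
  linear_combination -divVal W x y (n + 1) * h1

/-- The companion for the product x(Q + P) x(Q - P), which also needs the Somos-4 relation. -/
theorem phiVal_mul_phiVal (h : W.toAffine.Equation x y) (n : ℕ) :
    let X := phiVal W x y (n + 1)
    let Z := divVal W x y (n + 1) ^ 2
    phiVal W x y (n + 2) * phiVal W x y n =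
      X ^ 2 * x ^ 2 - W.b₄ * x * X * Z - W.b₆ * Z * (X + x * Z) - W.b₈ * Z ^ 2 := by
  have h1 := invar_divVal h n
  have h2 := ψ₂_sq_eq h
  have h3 := somos_four_divVal (W := W) (x := x) (y := y) n
  simp only [phiVal]
  rw [h2] at h1 h3
  simp only [Ψ₃, eval_add, eval_mul, eval_pow, eval_X, eval_C, eval_ofNat] at h3
  rw [show (n + 1 - 1 : ℤ) = n by ring, show (n + 1 + 1 : ℤ) = n + 2 by ring,
    show (n + 2 - 1 : ℤ) = n + 1 by ring, show (n + 2 + 1 : ℤ) = n + 3 by ring]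
  linear_combination -divVal W x y (n + 1) * x * h1 + divVal W x y (n + 1) ^ 2 * h3

end AddSub

end WeierstrassCurve
-- The x-coordinates of multiples over a field
namespace WeierstrassCurve

open NormEDS Polynomial

variable {F : Type*} [Field F] {W : WeierstrassCurve F} {x y : F}

/-- The numerator and the denominator of the duplication formula do not both vanish at a
nonsingular point. -/
theorem duplication_ne_zero (h : W.toAffine.Nonsingular x y) (hy : 2 * y + W.a₁ * x + W.a₃ = 0) :
    x ^ 4 - W.b₄ * x ^ 2 - 2 * W.b₆ * x - W.b₈ ≠ 0 := by
  obtain ⟨he, hn⟩ := (W.toAffine.nonsingular_iff x y).mp h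
  rw [Affine.equation_iff] at he
  intro h0
  -- Modulo the curve equation and `hy`, the duplication numerator is the square of this partial
  -- derivative.
  have hx : W.a₁ * y - (3 * x ^ 2 + 2 * W.a₂ * x + W.a₄) = 0 := by
    apply pow_eq_zero_iff two_ne_zero |>.mp
    simp only [b₄, b₆, b₈] at h0
    linear_combination h0 - (W.a₁ ^ 2 + 4 * W.a₂ + 8 * x) * he + (W.a₁ * (W.a₁ * y - (3 * x ^ 2 + 2 * W.a₂ * x + W.a₄)) +
      (W.a₂ + 2 * x) * (2 * y + W.a₁ * x + W.a₃)) * hy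
  rcases hn with h | h
  · exact h (sub_eq_zero.mp hx)
  · apply h
    linear_combination hy

theorem addX_add_addX_neg [DecidableEq F] {x' y' : F} (h : W.toAffine.Equation x y)
    (h' : W.toAffine.Equation x' y') (hx : x' ≠ x) :
    (W.toAffine.addX x' x (W.toAffine.slope x' x y' y) +
      W.toAffine.addX x' x (W.toAffine.slope x' x y' (W.toAffine.negY x y))) * (x' - x) ^ 2 =
      2 * x * x' * (x' + x) + W.b₂ * x * x' + W.b₄ * (x' + x) + W.b₆ := by
  rw [Affine.equation_iff] at h h'
  rw [Affine.slope_of_X_ne hx, Affine.slope_of_X_ne hx]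
  have := sub_ne_zero.mpr hx
  simp only [Affine.addX, Affine.negY, b₂, b₄, b₆]
  field_simp
  linear_combination 2 * h + 2 * h'

theorem addX_self [DecidableEq F] (h : W.toAffine.Equation x y) (hy : y ≠ W.toAffine.negY x y) :
    W.toAffine.addX x x (W.toAffine.slope x x y y) * (2 * y + W.a₁ * x + W.a₃) ^ 2 =
      x ^ 4 - W.b₄ * x ^ 2 - 2 * W.b₆ * x - W.b₈ := by
  rw [Affine.equation_iff] at h
  have hs : W.toAffine.slope x x y y * (2 * y + W.a₁ * x + W.a₃) =
      3 * x ^ 2 + 2 * W.a₂ * x + W.a₄ - W.a₁ * y := by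
    have h1 : y - W.toAffine.negY x y = 2 * y + W.a₁ * x + W.a₃ := by rw [Affine.negY]; ring
    rw [Affine.slope_of_Y_ne rfl hy, ← h1]
    exact div_mul_cancel₀ _ (sub_ne_zero.mpr hy)
  generalize W.toAffine.slope x x y y = ℓ at *
  simp only [Affine.addX, b₄, b₆, b₈]
  linear_combination (ℓ * (2 * y + W.a₁ * x + W.a₃) +
    (3 * x ^ 2 + 2 * W.a₂ * x + W.a₄ - W.a₁ * y) + W.a₁ * (2 * y + W.a₁ * x + W.a₃)) * hs -
    (W.a₁ ^ 2 + 4 * W.a₂ + 8 * x) * h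

/-- The affine or infinite `x`-coordinate of `Q` is given by `(X : Z)`. -/
def RepX (Q : W.toAffine.Point) (X Z : F) : Prop :=
  match Q with
  | .zero => Z = 0 ∧ X ≠ 0
  | .some x _ _ => Z ≠ 0 ∧ X = x * Z

variable [DecidableEq F]

/-- Two consecutive multiples are carried along because the addition formulas recover x(Q + P) from
x(Q) and x(Q - P). Only the point has to be nonsingular, not the curve, so this applies to bad
reductions. -/
theorem repX_nsmul (h : W.toAffine.Nonsingular x y) (n : ℕ) :
    RepX (n • Affine.Point.some x y h) (phiVal W x y n) (divVal W x y n ^ 2) ∧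
    RepX ((n + 1) • Affine.Point.some x y h) (phiVal W x y (n + 1)) (divVal W x y (n + 1) ^ 2) := by
  induction n with
  | zero =>
    refine ⟨?_, ?_⟩
    · rw [zero_smul]
      simp [RepX, phiVal, divVal]
    · rw [zero_add, one_smul]
      simp [RepX, phiVal, divVal]
  | succ n ih =>
    obtain ⟨ih0, ih1⟩ := ih
    refine ⟨by exact_mod_cast ih1, ?_⟩
    push_cast
    rw [show (n + 1 + 1 : ℤ) = n + 2 by ring]
    have e1 := divVal_sq_mul_divVal_sq (W := W) (x := x) (y := y) n
    have e2 := phiVal_mul_add h.1 n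
    have e3 := phiVal_mul_phiVal h.1 n
    dsimp only at e2 e3
    have hs := ψ₂_sq_eq h.1
    have hnext : (n + 1 + 1) • Affine.Point.some x y h =
      (n + 1) • Affine.Point.some x y h + Affine.Point.some x y h := succ_nsmul _ _
    have hprev : n • Affine.Point.some x y h =
        (n + 1) • Affine.Point.some x y h + -Affine.Point.some x y h := by
      rw [succ_nsmul, add_neg_cancel_right]
    rw [hnext]
    rw [hprev] at ih0
    clear hnext hprev
    generalize (n + 1) • Affine.Point.some x y h = Q at *
    generalize divVal W x y (n + 2) ^ 2 = Z2 at *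
    generalize divVal W x y (n + 1) ^ 2 = Z1 at *
    generalize divVal W x y n ^ 2 = Z0 at *
    generalize phiVal W x y (n + 2) = X2 at *
    generalize phiVal W x y (n + 1) = X1 at *
    generalize phiVal W x y n = X0 at *
    rw [Affine.Point.neg_some] at ih0
    obtain _ | ⟨x', y', h'⟩ := Q
    · rw [← Affine.Point.zero_def, zero_add] at *
      obtain ⟨hZ1, hX1⟩ := ih1
      obtain ⟨hZ0, hX0⟩ := ih0
      subst hZ1 hX0
      have hZ2 : Z2 ≠ 0 := by
        rintro rfl
        apply hX1
        simpa using e1.symm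
      refine ⟨hZ2, mul_right_cancel₀ hZ0 ?_⟩
      linear_combination e2 - 2 * x * e1
    · obtain ⟨hZ1, rfl⟩ := ih1
      -- If x(Q) = x(P) then Q = ±P. The subcases are P = -P, Q = P and Q = -P.
      by_cases hx : x' = x
      · subst hx
        have e1' : Z2 = 0 ∨ Z0 = 0 := by
          apply mul_eq_zero.mp
          linear_combination e1
        replace e2 : X2 * Z0 + X0 * Z2 = Z1 ^ 2 * (2 * y + W.a₁ * x' + W.a₃) ^ 2 := by
          linear_combination e2 - Z1 ^ 2 * hs
        replace e3 : X2 * X0 =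
            Z1 ^ 2 * (x' ^ 4 - W.b₄ * x' ^ 2 - 2 * W.b₆ * x' - W.b₈) := by
          linear_combination e3
        have hZ1' := pow_ne_zero 2 hZ1
        have hneg : y = W.toAffine.negY x' y ↔ 2 * y + W.a₁ * x' + W.a₃ = 0 := by
          rw [Affine.negY]
          constructor <;> intro h <;> linear_combination h
        -- Here both Q ± P are O; the product formula and `duplication_ne_zero` keep X2 nonzero.
        by_cases hS : 2 * y + W.a₁ * x' + W.a₃ = 0
        · have hy := hneg.mpr hS
          have hy' : y' = y := (Affine.Y_eq_of_X_eq h'.1 h.1 rfl).elim id (·.trans hy.symm)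
          rw [Affine.Point.add_of_Y_eq rfl (hy'.trans (W.toAffine.negY_negY x' y).symm)] at ih0
          rw [Affine.Point.add_of_Y_eq rfl (hy'.trans hy)]
          obtain ⟨rfl, hX0⟩ := ih0
          refine ⟨?_, ?_⟩
          · rw [hS] at e2
            simpa [hX0] using e2
          · rintro rfl
            rw [zero_mul] at e3
            exact mul_ne_zero hZ1' (duplication_ne_zero h hS) e3.symm
        have hy := mt hneg.mp hS
        rcases Affine.Y_eq_of_X_eq h'.1 h.1 rfl with rfl | rfl
        · rw [Affine.Point.add_of_Y_eq rfl (W.toAffine.negY_negY x' y').symm] at ih0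
          rw [Affine.Point.add_self_of_Y_ne hy]
          obtain ⟨rfl, hX0⟩ := ih0
          refine ⟨?_, mul_right_cancel₀ hX0 ?_⟩
          · rintro rfl
            simp [hZ1, hS] at e2
          · rw [e3, ← addX_self h.1 hy]
            linear_combination -W.toAffine.addX x' x' (W.toAffine.slope x' x' y' y') * e2
        · rw [Affine.Point.add_self_of_Y_ne
            (by rw [Affine.negY_negY]; exact Ne.symm hy)] at ih0
          rw [Affine.Point.add_of_Y_eq rfl rfl]
          obtain ⟨hZ0, -⟩ := ih0
          obtain rfl := e1'.resolve_right hZ0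
          refine ⟨rfl, ?_⟩
          rintro rfl
          simp [hZ1, hS] at e2
      · have hsum := addX_add_addX_neg h.1 h'.1 hx
        rw [Affine.Point.add_of_X_ne hx] at *
        obtain ⟨hZ0, rfl⟩ := ih0
        have hZ2 : Z2 ≠ 0 := by
          rintro rfl
          have : (x' - x) * Z1 = 0 := by
            apply pow_eq_zero_iff two_ne_zero |>.mp
            linear_combination -e1
          exact (mul_ne_zero (sub_ne_zero.mpr hx) hZ1) this
        refine ⟨hZ2, mul_right_cancel₀ hZ0 ?_⟩
        linear_combination e2 - Z1 ^ 2 * hsum -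
         (W.toAffine.addX x' x (W.toAffine.slope x' x y' y) +
      W.toAffine.addX x' x (W.toAffine.slope x' x y' (W.toAffine.negY x y))) * e1

end WeierstrassCurve
-- Denominators over ℚ and reduction modulo p
namespace EDS

open WeierstrassCurve Polynomial

theorem equation_baseChange_iff (E : WeierstrassCurve ℤ) (x y : ℚ) :
    (E.baseChange ℚ).toAffine.Equation x y ↔
      y ^ 2 + E.a₁ * x * y + E.a₃ * y = x ^ 3 + E.a₂ * x ^ 2 + E.a₄ * x + E.a₆ := by
  rw [Affine.equation_iff]
  rfl

/-- With g = gcd(z, D) and D = gD', coprimality gives D' ∣ g and g ∣ D', so |D| = g². -/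
theorem isSquare_of_mul_add_eq {z D M K : ℤ} (hD : D ≠ 0) (hK : IsCoprime K D)
    (h : z * (z + D * M) = D * K) : IsSquare D.natAbs := by
  obtain ⟨g, z', D', hg, hc, rfl, rfl⟩ : ∃ g z' D' : ℤ, g ≠ 0 ∧ IsCoprime z' D' ∧
      z = g * z' ∧ D = g * D' := by
    have hg : 0 < Int.gcd z D := Int.gcd_pos_of_ne_zero_right _ hD
    obtain ⟨z', D', hc, h1, h2⟩ := Int.exists_gcd_one hg
    exact ⟨Int.gcd z D, z', D', by exact_mod_cast hg.ne', Int.isCoprime_iff_gcd_eq_one.mpr hc,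
      h1.trans (mul_comm _ _), h2.trans (mul_comm _ _)⟩
  have h' : g * (z' * (z' + D' * M)) = D' * K := mul_left_cancel₀ hg (by linear_combination h)
  have h1 : D' ∣ g := by
    refine IsCoprime.dvd_of_dvd_mul_right ?_ (Dvd.intro _ h'.symm)
    exact IsCoprime.mul_right hc.symm (by simpa using hc.symm.add_mul_left_right M)
  have h2 : g ∣ D' :=
    IsCoprime.dvd_of_dvd_mul_right (hK.of_isCoprime_of_dvd_right (Dvd.intro _ rfl)).symm
      (Dvd.intro _ h')
  exact ⟨g.natAbs, by rw [Int.natAbs_mul, Int.natAbs_eq_of_dvd_dvd h1 h2]⟩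

/-- The denominator of the `x`-coordinate of a rational point is a square, and its square clears
the denominator of `y`. -/
theorem isSquare_den {E : WeierstrassCurve ℤ} {x y : ℚ}
    (h : (E.baseChange ℚ).toAffine.Equation x y) :
    IsSquare x.den ∧ ∃ z : ℤ, y * x.den ^ 2 = z := by
  rw [equation_baseChange_iff] at h
  have hx : x * x.den = x.num := Rat.mul_den_eq_num x
  set A := x.num with hA
  set K := A ^ 3 + E.a₂ * A ^ 2 * x.den + E.a₄ * A * x.den ^ 2 + E.a₆ * x.den ^ 3 with hK
  have key : (y * x.den ^ 2) * (y * x.den ^ 2 + x.den * (E.a₁ * A + E.a₃ * x.den : ℤ)) =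
      x.den * (K : ℤ) := by
    rw [hK]
    push_cast
    rw [← hx]
    linear_combination (x.den : ℚ) ^ 4 * h
  -- `key` is the curve equation times D⁴, read as a monic integral quadratic in yD².
  have hint : _root_.IsIntegral ℤ (y * x.den ^ 2) := by
    refine ⟨X ^ 2 + (C (x.den * (E.a₁ * A + E.a₃ * x.den)) * X - C (x.den * K)), ?_, ?_⟩
    · apply monic_X_pow_add
      compute_degree!
    · rw [← aeval_def]
      simp only [map_add, map_sub, map_mul, map_pow, aeval_X, aeval_C]
      simp only [algebraMap_int_eq, eq_intCast, Int.cast_natCast]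
      push_cast at key ⊢
      linear_combination key
  obtain ⟨z, hz⟩ := IsIntegrallyClosed.isIntegral_iff.mp hint
  replace hz : y * x.den ^ 2 = z := by simpa using hz.symm
  refine ⟨?_, z, hz⟩
  rw [hz] at key
  have hcop : IsCoprime K (x.den : ℤ) := by
    have h1 : IsCoprime (A ^ 3) (x.den : ℤ) :=
      (Int.isCoprime_iff_gcd_eq_one.mpr (by simpa [Int.gcd] using x.reduced)).pow_left
    have := h1.add_mul_right_left (E.a₂ * A ^ 2 + E.a₄ * A * x.den + E.a₆ * x.den ^ 2)
    rwa [show A ^ 3 + (E.a₂ * A ^ 2 + E.a₄ * A * x.den + E.a₆ * x.den ^ 2) * x.den = K by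
      rw [hK]; ring] at this
  simpa using isSquare_of_mul_add_eq (by exact_mod_cast x.den_ne_zero) hcop
    (by exact_mod_cast key : z * (z + x.den * (E.a₁ * A + E.a₃ * x.den)) = x.den * K)

/-- The value `D ^ k * f (A / D)`, as an integer. -/
def homEval (f : ℤ[X]) (k : ℕ) (A D : ℤ) : ℤ :=
  ∑ i ∈ Finset.range (k + 1), f.coeff i * A ^ i * D ^ (k - i)

theorem map_homEval {K : Type*} [Field K] (φ : ℤ →+* K) {f : ℤ[X]} {k : ℕ} (hf : f.natDegree ≤ k)
    {A D : ℤ} (hD : φ D ≠ 0) :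
    φ (homEval f k A D) = φ D ^ k * (f.map φ).eval (φ A / φ D) := by
  rw [eval_map, eval₂_eq_sum_range' φ (Nat.lt_succ_of_le hf), homEval, map_sum, Finset.mul_sum]
  refine Finset.sum_congr rfl fun i hi ↦ ?_
  obtain ⟨j, rfl⟩ := Nat.exists_eq_add_of_le (Nat.lt_succ_iff.mp (Finset.mem_range.mp hi))
  rw [Nat.add_sub_cancel_left, map_mul, map_mul, map_pow, map_pow, pow_add, div_pow]
  field_simp

theorem homEval_modEq {f : ℤ[X]} {k : ℕ} {A D p : ℤ} (hp : p ∣ D) :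
    p ∣ homEval f k A D - f.coeff k * A ^ k := by
  rw [homEval, Finset.sum_range_succ, Nat.sub_self, pow_zero, mul_one, add_sub_cancel_right]
  refine Finset.dvd_sum fun i hi ↦ Dvd.dvd.mul_left ?_ _
  exact dvd_pow hp (Nat.sub_ne_zero_of_lt (Finset.mem_range.mp hi))

theorem localOrder_eq_one {E : WeierstrassCurve ℤ} {P : Pt E ℚ} (hM : M E P = 1) (p : ℕ)
    [Fact p.Prime] : localOrder E p P = 1 := by
  have hne : {N : ℕ | 0 < N ∧ ∀ (p : ℕ) [Fact p.Prime], localOrder E p P ∣ N}.Nonempty := by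
    -- The infimum of the empty set is 0, so the value 1 is attained.
    apply Nat.nonempty_of_pos_sInf
    rw [← M.eq_def, hM]
    exact one_pos
  have := Nat.sInf_mem hne
  rw [← M.eq_def, hM] at this
  exact Nat.dvd_one.mp (this.2 p)

open Classical in
theorem map_mem_nonsingularReduction {E : WeierstrassCurve ℤ} {P : Pt E ℚ} (hM : M E P = 1)
    (p : ℕ) [Fact p.Prime] :
    (Affine.Point.map (W' := E.toAffine) (Algebra.ofId ℚ ℚ_[p]) P : Pt E ℚ_[p]) ∈
      nonsingularReduction E p := by
  have h1 := localOrder_eq_one hM p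
  have hne := Nat.nonempty_of_pos_sInf (h1.symm ▸ one_pos : 0 < localOrder E p P)
  have := Nat.sInf_mem hne
  rw [← localOrder.eq_def, h1] at this
  simpa using this.2

/-- The reduction modulo `p` of a point with `x = A / D`, `y = z / D ^ 2` is nonsingular. -/
theorem nonsingular_zmod {E : WeierstrassCurve ℤ} {x y : ℚ}
    {h : (E.baseChange ℚ).toAffine.Nonsingular x y}
    (hM : M E (Affine.Point.some x y h : Pt E ℚ) = 1) {z : ℤ} (hz : y * x.den ^ 2 = z) (p : ℕ)
    [Fact p.Prime] (hp : ¬p ∣ x.den) :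
    (E.map (Int.castRingHom (ZMod p))).toAffine.Nonsingular
      ((x.num : ZMod p) / x.den) ((z : ZMod p) / x.den ^ 2) := by
  have hD : (x.den : ZMod p) ≠ 0 := by rwa [Ne, ZMod.natCast_eq_zero_iff]
  have hnorm : ‖(x.den : ℚ_[p])‖ = 1 := by
    simpa using (Padic.norm_natCast_eq_one_iff (p := p) (n := x.den)).mpr
      ((Nat.Prime.coprime_iff_not_dvd Fact.out).mpr hp)
  have hx : ‖(x : ℚ_[p])‖ ≤ 1 := Padic.norm_rat_le_one hp
  have hy' : (y : ℚ_[p]) * x.den ^ 2 = z := by exact_mod_cast congr_arg (Rat.cast (K := ℚ_[p])) hz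
  have hy : ‖(y : ℚ_[p])‖ ≤ 1 := by
    have := congr_arg norm hy'
    rw [norm_mul, norm_pow, hnorm, one_pow, mul_one] at this
    rw [this]
    exact Padic.norm_int_le_one z
  obtain ⟨x', hx'⟩ : ∃ x' : ℤ_[p], (x' : ℚ_[p]) = x := ⟨⟨x, hx⟩, rfl⟩
  obtain ⟨y', hy''⟩ : ∃ y' : ℤ_[p], (y' : ℚ_[p]) = y := ⟨⟨y, hy⟩, rfl⟩
  have key := map_mem_nonsingularReduction hM p x' y' (by simp [hx']) (by simp [hy''])
  have e1 : PadicInt.toZMod x' = (x.num : ZMod p) / x.den := by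
    rw [eq_div_iff hD]
    have : x' * x.den = x.num := by
      apply Subtype.ext
      push_cast
      rw [hx']
      exact_mod_cast congr_arg (Rat.cast (K := ℚ_[p])) (Rat.mul_den_eq_num x)
    simpa using congr_arg PadicInt.toZMod this
  have e2 : PadicInt.toZMod y' = (z : ZMod p) / x.den ^ 2 := by
    rw [eq_div_iff (pow_ne_zero 2 hD)]
    have : y' * x.den ^ 2 = z := by
      apply Subtype.ext
      push_cast
      rw [hy'', hy']
    simpa using congr_arg PadicInt.toZMod this
  rwa [e1, e2] at key

theorem natDegree_Φ_le_sq (E : WeierstrassCurve ℤ) (n : ℕ) : (E.Φ n).natDegree ≤ n ^ 2 :=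
  E.natDegree_Φ_le n

theorem natDegree_ΨSq_le_sq (E : WeierstrassCurve ℤ) (n : ℕ) : (E.ΨSq n).natDegree ≤ n ^ 2 :=
  (E.natDegree_ΨSq_le n).trans (Nat.sub_le _ _)

theorem phi_psi_not_both_zero {F : Type*} [Field F] {W : WeierstrassCurve F} {x y : F}
    (h : W.toAffine.Nonsingular x y) (n : ℕ) (h1 : (W.Φ n).eval x = 0)
    (h2 : (W.ΨSq n).eval x = 0) : False := by
  classical
  have := (repX_nsmul h n).1
  rw [← eval_Φ h.1, ← eval_ΨSq h.1, h1, h2] at this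
  generalize n • Affine.Point.some x y h = Q at this
  cases Q <;> simp [RepX] at this

/-- This is where M(P) = 1 enters: a common prime factor not dividing the denominator of x would
give a common zero of Φ_n and ΨSq_n at a nonsingular point modulo p. -/
theorem isCoprime_homEval {E : WeierstrassCurve ℤ} {x y : ℚ}
    {h : (E.baseChange ℚ).toAffine.Nonsingular x y}
    (hM : M E (Affine.Point.some x y h : Pt E ℚ) = 1) (n : ℕ) :
    IsCoprime (homEval (E.Φ n) (n ^ 2) x.num x.den) (homEval (E.ΨSq n) (n ^ 2) x.num x.den) := by
  obtain ⟨-, z, hz⟩ := isSquare_den h.1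
  rw [Int.isCoprime_iff_gcd_eq_one]
  by_contra hg
  obtain ⟨p, hp, hpg⟩ := Nat.exists_prime_and_dvd hg
  have h1 : (p : ℤ) ∣ homEval (E.Φ n) (n ^ 2) x.num x.den :=
    (Int.natCast_dvd_natCast.mpr hpg).trans (Int.gcd_dvd_left ..)
  have h2 : (p : ℤ) ∣ homEval (E.ΨSq n) (n ^ 2) x.num x.den :=
    (Int.natCast_dvd_natCast.mpr hpg).trans (Int.gcd_dvd_right ..)
  have : Fact p.Prime := ⟨hp⟩
  by_cases hpD : p ∣ x.den
  · have h3 := homEval_modEq (f := E.Φ n) (k := n ^ 2) (A := x.num)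
      (Int.natCast_dvd_natCast.mpr hpD)
    -- Modulo p only the leading term A^(n²) survives, forcing p ∣ A.
    have hc : (E.Φ n).coeff (n ^ 2) = 1 := by simpa using E.coeff_Φ n
    rw [hc, one_mul, dvd_sub_right h1] at h3
    have h4 := (Nat.prime_iff_prime_int.mp hp).dvd_of_dvd_pow h3
    exact Nat.not_coprime_of_dvd_of_dvd hp.one_lt (Int.natCast_dvd.mp h4) hpD x.reduced
  · have hns := nonsingular_zmod hM hz p hpD
    have hD : (x.den : ZMod p) ≠ 0 := by rwa [Ne, ZMod.natCast_eq_zero_iff]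
    have hD' : Int.castRingHom (ZMod p) x.den ≠ 0 := by simpa using hD
    have e1 := map_homEval (Int.castRingHom (ZMod p)) (A := x.num) (k := n ^ 2)
      (natDegree_Φ_le_sq E n) hD'
    have e2 := map_homEval (Int.castRingHom (ZMod p)) (A := x.num) (k := n ^ 2)
      (natDegree_ΨSq_le_sq E n) hD'
    rw [← map_Φ, eq_intCast, (ZMod.intCast_zmod_eq_zero_iff_dvd _ p).mpr h1, eq_comm,
      mul_eq_zero_iff_left (pow_ne_zero _ hD')] at e1
    rw [← map_ΨSq, eq_intCast, (ZMod.intCast_zmod_eq_zero_iff_dvd _ p).mpr h2, eq_comm,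
      mul_eq_zero_iff_left (pow_ne_zero _ hD')] at e2
    simp only [eq_intCast, Int.cast_natCast] at e1 e2
    exact phi_psi_not_both_zero hns n e1 e2

theorem den_eq_of_mul_eq {q : ℚ} {a b : ℤ} (hb : 0 < b) (hab : IsCoprime a b) (h : (a : ℚ) = q * b) :
    (q.den : ℤ) = b := by
  have hq : q = (a : ℚ) / b := by
    rw [h, mul_div_cancel_right₀]
    exact_mod_cast hb.ne'
  rw [hq]
  exact Rat.den_div_eq_of_coprime hb (Int.isCoprime_iff_gcd_eq_one.mp hab)

/-- By coprimality, the homogenised ΨSq_n, which equals (b^(n²) ψ_n)², is the exact denominator of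
x(nP). -/
theorem denomRoot_nsmul {E : WeierstrassCurve ℤ} {x y : ℚ}
    {h : (E.baseChange ℚ).toAffine.Nonsingular x y}
    (hM : M E (Affine.Point.some x y h : Pt E ℚ) = 1) {b : ℕ} (hb : x.den = b * b) (n : ℕ) :
    (B E (Affine.Point.some x y h : Pt E ℚ) n : ℚ) =
      b ^ n ^ 2 * |divVal (E.baseChange ℚ) x y n| := by
  have hrep := (repX_nsmul h n).1
  have hcop := isCoprime_homEval hM n
  have hD : Int.castRingHom ℚ x.den ≠ 0 := by simp
  have hxe : (Int.castRingHom ℚ x.num) / (Int.castRingHom ℚ x.den) = x := by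
    simpa using Rat.num_div_den x
  have e1 := map_homEval (Int.castRingHom ℚ) (A := x.num) (k := n ^ 2)
    (natDegree_Φ_le_sq E n) hD
  have e2 := map_homEval (Int.castRingHom ℚ) (A := x.num) (k := n ^ 2)
    (natDegree_ΨSq_le_sq E n) hD
  rw [hxe, ← map_Φ] at e1
  rw [hxe, ← map_ΨSq] at e2
  replace e1 := e1.trans (congr_arg _ (eval_Φ h.1 n))
  replace e2 := e2.trans (congr_arg _ (eval_ΨSq h.1 n))
  rw [B]
  generalize n • (Affine.Point.some x y h : Pt E ℚ) = Q at *
  obtain _ | ⟨x', y', h'⟩ := Q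
  · obtain ⟨h0, -⟩ := hrep
    rw [pow_eq_zero_iff two_ne_zero |>.mp h0]
    simp [denomRoot]
  · obtain ⟨h0, hX⟩ := hrep
    set a := homEval (E.Φ n) (n ^ 2) x.num x.den
    set c := homEval (E.ΨSq n) (n ^ 2) x.num x.den
    simp only [eq_intCast, Int.cast_natCast] at e1 e2
    have hc2 : (c : ℚ) = (b ^ n ^ 2 * |divVal (E.baseChange ℚ) x y n|) ^ 2 := by
      rw [e2, hb, mul_pow, sq_abs]
      push_cast
      ring
    have hc0 : 0 < c := by
      have : (0 : ℚ) < c := by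
        rw [e2]
        exact mul_pos (pow_pos (by exact_mod_cast x.den_pos) _) (by positivity)
      exact_mod_cast this
    have hden := den_eq_of_mul_eq hc0 hcop (q := x') (by rw [e1, e2, hX]; ring)
    obtain ⟨s, hs⟩ : IsSquare x'.den := (isSquare_den h'.1).1
    rw [denomRoot, hs, Nat.sqrt_eq]
    refine (pow_left_inj₀ (by positivity) (by positivity) two_ne_zero).mp ?_
    rw [← hc2, ← hden, hs]
    push_cast
    ring

theorem beta_eq {E : WeierstrassCurve ℤ} {x y : ℚ}
    {h : (E.baseChange ℚ).toAffine.Nonsingular x y}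
    (hM : M E (Affine.Point.some x y h : Pt E ℚ) = 1) {b : ℕ} (hb : x.den = b * b) (n : ℕ) :
    beta E (Affine.Point.some x y h : Pt E ℚ) n =
      b ^ n ^ 2 * divVal (E.baseChange ℚ) x y n / b := by
  have h1 : (B E (Affine.Point.some x y h : Pt E ℚ) 1 : ℚ) = b := by
    rw [denomRoot_nsmul hM hb 1]
    simp [divVal]
  rw [beta, h1, denomRoot_nsmul hM hb n, psiAt, evalEval_ψ]
  rw [mul_div_assoc', mul_left_comm, sign_mul_abs]

end EDS

theorem corollary4p3 (E : WeierstrassCurve ℤ) (hE : (E.baseChange ℚ).IsElliptic)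
    (P : EDS.Pt E ℚ) (hP : P ≠ 0) (htors : IsOfFinAddOrder P) (hM : EDS.M E P = 1)
    (m n r : ℕ) (hnm : n ≤ m) (hrn : r ≤ n) :
    EDS.beta E P (m + n) * EDS.beta E P (m - n) * EDS.beta E P r ^ 2 =
      EDS.beta E P (m + r) * EDS.beta E P (m - r) * EDS.beta E P n ^ 2 -
        EDS.beta E P (n + r) * EDS.beta E P (n - r) * EDS.beta E P m ^ 2 := by
  obtain _ | ⟨x, y, h⟩ := P
  · exact absurd rfl hP
  obtain ⟨b, hb⟩ := (EDS.isSquare_den h.1).1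
  obtain ⟨k, rfl⟩ := Nat.exists_eq_add_of_le hrn
  obtain ⟨l, rfl⟩ := Nat.exists_eq_add_of_le hnm
  have key := NormEDS.elliptic_relation (2 * y + (E.baseChange ℚ).a₁ * x + (E.baseChange ℚ).a₃)
    ((E.baseChange ℚ).Ψ₃.eval x) ((E.baseChange ℚ).preΨ₄.eval x)
    (m := (r + k + l : ℕ)) (n := (r + k : ℕ)) (r := r) (by omega) (by omega) (by omega)
  simp only [← WeierstrassCurve.divVal.eq_def] at key
  rw [Nat.add_sub_cancel_left, Nat.add_sub_cancel_left, show r + k + l - r = k + l by omega]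
  simp only [EDS.beta_eq hM hb]
  rw [← Nat.cast_add, ← Nat.cast_add, ← Nat.cast_add, ← Nat.cast_sub (by omega),
    ← Nat.cast_sub (by omega), ← Nat.cast_sub (by omega), Nat.add_sub_cancel_left,
    Nat.add_sub_cancel_left, show r + k + l - r = k + l by omega] at key
  -- All three products carry the same power of b: the squared indices sum to 2(m² + n² + r²), and
  -- the four factors contribute b⁻⁴.
  linear_combination (b : ℚ) ^ (2 * ((r + k + l) ^ 2 + (r + k) ^ 2 + r ^ 2)) / b ^ 4 * key
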